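/- **Setting.** Let $k\ge 1$ and let $V$ be the vertex set of the semi-infinite Cayley tree of order $k$: the vertices are the finite sequences $x=(i_1,\dots,i_n)$, $i_m\in\{1,\dots,k\}$, the root $o$ is the empty sequence, the direct successors of $x$ are $(x,1),\dots,(x,k)$, $W_n$ is the set of sequences of length $n$ and $\Lambda_n=\bigcup_{m\le n}W_m$. A ray is a sequence $r=(x_n)_{n\ge0}$ with $x_0=o$ and $x_{n+1}$ a direct successor of $x_n$. Let $\mathcal A\subseteq B(H)$ be a unital C$^*$-algebra of operators on a complex Hilbert space $H$, and let $\mathrm{Tr}$ be the usual trace on positive operators, with values in $[0,\infty]$. Put $\mathcal A_{\Lambda_n}=\bigotimes_{x\in\Lambda_n}\mathcal A$ and $\mathcal A_{loc}=\bigcup_n\mathcal A_{\Lambda_n}$, where $\mathcal A_{\Lambda_n}$ is embedded in $\mathcal A_{\Lambda_{n+1}}$ by $a\mapsto a\otimes 1$. Let $\alpha_j$ be the shift of $\mathcal A_{loc}$ that moves the factor at $x$ to $(j,x)$, and let $\alpha_o(e)$ denote $e$ placed at the root. Let $\mathcal E:\mathcal A_{\Lambda_1}=\mathcal A_o\otimes\mathcal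 A_{(1)}\otimes\cdots\otimes\mathcal A_{(k)}\to\mathcal A$ be linear, completely positive and identity preserving, let $\mathcal E_u$ be its copy at $u\in V$, let $E_{\Lambda_n}=\mathrm{id}_{\Lambda_{n-1}}\otimes\bigotimes_{u\in W_n}\mathcal E_u:\mathcal A_{\Lambda_{n+1}}\to\mathcal A_{\Lambda_n}$, and let $E_{o]}(a)=E_{\Lambda_0}\circ\cdots\circ E_{\Lambda_n}(a\otimes 1)$ for $a\in\mathcal A_{\Lambda_n}$. Let $\phi_o$ be a state on $\mathcal A$ and $\varphi=\phi_o\circ E_{o]}$, and assume $\varphi\circ\alpha_j=\varphi$ for $j=1,\dots,k$; that is, $\varphi\equiv(\phi_o,\mathcal E)$ is a tree-homogeneous quantum Markov chain with trivial boundary condition. For a projection $e\in\mathcal A$, $e^\perp=1-e$, and a ray $r=(x_n)$ let $\tau_{e;x_n}=e^{\perp(x_0)}\otimes\cdots\otimes e^{\perp(x_{n-1})}\otimes e^{(x_n)}\otimes 1$ and $e\otimes\tau_{e;x_n}=\alpha_o(e)\,\alpha_{x_1}(\tau_{e;x_n})$. The projection $e$ is *$\mathcal E$-recurrent* if $0<\mathrm{Tr}(\mathcal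 E(e\otimes1))<\infty$ and, for every ray, $$\frac1{\mathrm{Tr}(\mathcal E(e\otimes 1))}\sum_{n\ge0}\mathrm{Tr}\big(E_{o]}(e\otimes\tau_{e;x_n})\big)=1 .$$ It is *$\varphi$-recurrent* if $\varphi(\alpha_o(e))\ne0$ and, for every ray, $$\frac1{\varphi(\alpha_o(e))}\sum_{n\ge0}\varphi(e\otimes\tau_{e;x_n})=1 .$$ **Statement.** Let $\varphi\equiv(\phi_o,\mathcal E)$ be a tree-homogeneous quantum Markov chain as above. 1. Every $\mathcal E$-recurrent projection $e$ with $\varphi(\alpha_o(e))\neq0$ is $\varphi$-recurrent. 2. If the initial state $\phi_o$ is faithful, then every $\mathcal E$-recurrent projection is $\varphi$-recurrent (without a further condition), and every $\varphi$-recurrent projection $e$ with $\mathrm{Tr}(\mathcal E(e\otimes1))<\infty$ is $\mathcal E$-recurrent. -/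

import Mathlib

open scoped TensorProduct ENNReal
open PiTensorProduct

noncomputable section

namespace TreeQMC

/-! ### The semi-infinite Cayley tree

A vertex is its list of coordinates: the root `o` is `[]`, and the direct successors of `x` are
`x ++ [j]` for `j : Fin k`.  The level of a vertex is the length of the list. -/

/-- Vertices of the semi-infinite Cayley tree of order `k`. -/
abbrev Vertex (k : ℕ) : Type := List (Fin k)

/-- `Ball k n` is the set of vertices at distance at most `n` from the root. -/
abbrev Ball (k n : ℕ) : Type := {x : Vertex k // x.length ≤ n}

/-- `y` is a direct successor of `x`. -/
def IsSuccessor {k : ℕ} (x y : Vertex k) : Prop := ∃ j : Fin k, y = x ++ [j]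

/-- A ray: an infinite path that starts at the root and moves away from it. -/
structure Ray (k : ℕ) where
  vert : ℕ → Vertex k
  vert_zero : vert 0 = []
  vert_succ : ∀ n, IsSuccessor (vert n) (vert (n + 1))

/-- The first vertex `x₁ = (j)` of a ray after the root, given by its single coordinate `j`. -/
def Ray.first {k : ℕ} (r : Ray k) : Fin k := (r.vert_succ 0).choose

theorem Ray.vert_one {k : ℕ} (r : Ray k) : r.vert 1 = [r.first] := by
  have h : r.vert 1 = r.vert 0 ++ [r.first] := (r.vert_succ 0).choose_spec
  rw [h, r.vert_zero, List.nil_append]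

/-! ### Local algebras -/

section Algebra

variable {A : Type*} [Ring A] [Algebra ℂ A]

/-- The algebra `⨂_{x ∈ Λ_n} A` of the ball `Λ_n` of radius `n`. -/
abbrev BallAlg (k : ℕ) (A : Type*) [Ring A] [Algebra ℂ A] (n : ℕ) : Type _ :=
  ⨂[ℂ] _ : Ball k n, A

theorem extend_update {A ι κ : Type*} [One A] [DecidableEq ι] [DecidableEq κ] (f : ι → κ)
   
    (hf : Function.Injective f) (a : ι → A) (i : ι) (v : A) :
    Function.extend f (Function.update a i v) 1
      = Function.update (Function.extend f a 1) (f i) v := by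
  funext y
  by_cases hy : ∃ x, f x = y
  · obtain ⟨x, rfl⟩ := hy
    rw [hf.extend_apply]
    by_cases hx : x = i
    · subst hx; simp
    · rw [Function.update_of_ne hx, Function.update_of_ne (fun h => hx (hf h)), hf.extend_apply]
  · rw [Function.extend_apply' _ _ _ hy, Function.update_of_ne, Function.extend_apply' _ _ _ hy]
    rintro rfl
    exact hy ⟨i, rfl⟩

/-- For an injection `f` of index sets, the natural embedding
`⨂_{i} A → ⨂_{j} A` that moves the factor at `i` to the place `f i` and puts `1` at all other
places. -/
def push {ι κ : Type*} (f : ι → κ) (hf : Function.Injective f) :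
    (⨂[ℂ] _ : ι, A) →ₗ[ℂ] (⨂[ℂ] _ : κ, A) :=
  PiTensorProduct.lift
    { toFun := fun a => tprod ℂ (Function.extend f a 1)
      map_update_add' := by
        classical
        intro _ a i v w
        simp only [extend_update f hf, MultilinearMap.map_update_add]
      map_update_smul' := by
        classical
        intro _ a i c v
        simp only [extend_update f hf, MultilinearMap.map_update_smul] }

@[simp] theorem push_tprod {ι κ : Type*} (f : ι → κ) (hf : Function.Injective f) (a : ι → A) :
    push f hf (tprod ℂ a) = tprod ℂ (Function.extend f a 1) := by
  simp [push]

/-- The inclusion `Λ_m ⊆ Λ_n`. -/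
def incl {k m n : ℕ} (h : m ≤ n) (x : Ball k m) : Ball k n := ⟨x.1, x.2.trans h⟩

theorem incl_injective {k m n : ℕ} (h : m ≤ n) :
    Function.Injective (incl h : Ball k m → Ball k n) :=
  fun _ _ hxy => Subtype.ext (congrArg (fun z : Ball k n => z.1) hxy)

/-- The embedding `a ↦ a ⊗ 1` of the algebra of `Λ_m` into the algebra of `Λ_n`. -/
def embed {k : ℕ} (m n : ℕ) (h : m ≤ n) : BallAlg k A m →ₗ[ℂ] BallAlg k A n :=
  push (incl h) (incl_injective h)

/-- The vertex shift `x ↦ (j, x)`. -/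
def shiftVertex {k : ℕ} (j : Fin k) (n : ℕ) (x : Ball k n) : Ball k (n + 1) :=
  ⟨j :: x.1, by simpa using x.2⟩

theorem shiftVertex_injective {k : ℕ} (j : Fin k) (n : ℕ) :
    Function.Injective (shiftVertex j n) := by
  intro x y hxy
  have h := congrArg (fun z : Ball k (n + 1) => z.1) hxy
  exact Subtype.ext (List.cons_injective h)

/-- The shift `α_j` from the algebra of `Λ_n` into the algebra of `Λ_{n+1}`. -/
def shiftBall {k : ℕ} (j : Fin k) (n : ℕ) : BallAlg k A n →ₗ[ℂ] BallAlg k A (n + 1) :=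
  push (shiftVertex j n) (shiftVertex_injective j n)

/-- The root as a point of `Λ_n`. -/
def rootOf (k n : ℕ) : Ball k n := ⟨[], Nat.zero_le n⟩

/-- The element `a⁽ᵒ⁾ ⊗ 1` of the algebra of `Λ_n`, that is `α_o(a)`. -/
def atRoot (k n : ℕ) (a : A) : BallAlg k A n :=
  tprod ℂ (Function.update 1 (rootOf k n) a)

theorem push_id {ι : Type*} (f : ι → ι) (hf : Function.Injective f) (h : ∀ x, f x = x)
    (a : ⨂[ℂ] _ : ι, A) : push f hf a = a := by
  obtain rfl : f = id := funext h
  have : push (A := A) id hf = LinearMap.id := by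
    apply PiTensorProduct.ext
    ext b
    simp only [LinearMap.compMultilinearMap_apply, push_tprod, LinearMap.id_apply]
    congr 1
    funext i
    exact hf.extend_apply b 1 i
  rw [this]; rfl

theorem push_push {ι κ μ : Type*} (f : ι → κ) (hf : Function.Injective f) (g : κ → μ)
    (hg : Function.Injective g) (p : ι → μ) (hp : Function.Injective p) (h : ∀ x, g (f x) = p x)
    (a : ⨂[ℂ] _ : ι, A) : push g hg (push f hf a) = push p hp a := by
  obtain rfl : g ∘ f = p := funext h
  have : push (A := A) g hg ∘ₗ push f hf = push (g ∘ f) hp := by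
    apply PiTensorProduct.ext
    ext b
    simp only [LinearMap.compMultilinearMap_apply, LinearMap.comp_apply, push_tprod]
    congr 1
    funext z
    by_cases hz : ∃ y, g y = z
    · obtain ⟨y, rfl⟩ := hz
      rw [hg.extend_apply]
      by_cases hy : ∃ x, f x = y
      · obtain ⟨x, rfl⟩ := hy
        rw [hf.extend_apply]
        exact (hp.extend_apply b 1 x).symm
      · rw [Function.extend_apply' _ _ _ hy, Function.extend_apply']
        · rfl
        · rintro ⟨x, hx⟩
          exact hy ⟨x, hg hx⟩
    · rw [Function.extend_apply' _ _ _ hz, Function.extend_apply']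
      rintro ⟨x, hx⟩
      exact hz ⟨f x, hx⟩
  exact LinearMap.congr_fun this a

theorem shiftBall_embed {k : ℕ} (j : Fin k) (m n : ℕ) (h : m ≤ n) (a : BallAlg k A m) :
    shiftBall j n (embed m n h a)
      = embed (m + 1) (n + 1) (Nat.succ_le_succ h) (shiftBall j m a) := by
  have hp : Function.Injective (shiftVertex j n ∘ (incl h : Ball k m → Ball k n)) :=
    (shiftVertex_injective j n).comp (incl_injective h)
  exact (push_push (incl h) (incl_injective h) (shiftVertex j n) (shiftVertex_injective j n) _ hp
    (fun _ => rfl) a).trans (push_push (shiftVertex j m) (shiftVertex_injective j m)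
    (incl (Nat.succ_le_succ h)) (incl_injective _) _ hp (fun _ => rfl) a).symm

/-- The local algebra: the union of the algebras of the balls `Λ_n`, each embedded in the next
one by `a ↦ a ⊗ 1`. -/
abbrev LocalAlg (k : ℕ) (A : Type*) [Ring A] [Algebra ℂ A] : Type _ :=
  Module.DirectLimit (R := ℂ) (fun n : ℕ => BallAlg k A n) (fun m n h => embed m n h)

/-- The inclusion of the algebra of `Λ_n` in the local algebra. -/
def toLocal (k n : ℕ) : BallAlg k A n →ₗ[ℂ] LocalAlg k A :=
  Module.DirectLimit.of ℂ ℕ (fun n : ℕ => BallAlg k A n) (fun m n h => embed m n h) n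

/-- The shift `α_j` on the local algebra. -/
def shift {k : ℕ} (j : Fin k) : LocalAlg k A →ₗ[ℂ] LocalAlg k A :=
  Module.DirectLimit.lift ℂ ℕ (fun n : ℕ => BallAlg k A n) (fun m n h => embed m n h)
    (fun n => toLocal k (n + 1) ∘ₗ shiftBall j n)
    (fun m n h a => by
      rw [LinearMap.comp_apply, LinearMap.comp_apply, shiftBall_embed]
      exact Module.DirectLimit.of_f)

/-! ### The conditional expectation generated by a transition expectation

The domain of a transition expectation `𝓔` is `A_o ⊗ A_(1) ⊗ ⋯ ⊗ A_(k)`, the algebra of the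
ball of radius one. -/

/-- The family of factors that `𝓔_u`, the copy of `𝓔` at `u`, sees: the factors at `u` and at its
direct successors. -/
def starAt {k n : ℕ} (u : Ball k n) (a : Ball k (n + 1) → A) : Ball k 1 → A :=
  fun y => a ⟨u.1 ++ y.1, by
    have h1 := u.2
    have h2 := y.2
    rw [List.length_append]; omega⟩

/-- The factors of `E_{Λ_n} (⨂ a_x)`: unchanged below level `n`, and
`𝓔_u (a_u ⊗ a_(u,1) ⊗ ⋯ ⊗ a_(u,k))` at every `u` in level `n`. -/
def levelFun {k : ℕ} (E : BallAlg k A 1 →ₗ[ℂ] A) (n : ℕ) (a : Ball k (n + 1) → A) :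
    Ball k n → A := fun u =>
  if u.1.length < n then a (incl (Nat.le_succ n) u) else E (tprod ℂ (starAt u a))

/-- The vertex of `Λ_n` whose factor in `levelFun` depends on the factor at `z`. -/
def target {k n : ℕ} (z : Ball k (n + 1)) : Ball k n := ⟨z.1.take n, by simp⟩

theorem levelFun_update {k : ℕ} (E : BallAlg k A 1 →ₗ[ℂ] A) (n : ℕ)
    [DecidableEq (Ball k (n + 1))] [DecidableEq (Ball k n)]
    (a : Ball k (n + 1) → A) (z : Ball k (n + 1)) :
    ∃ L : A →ₗ[ℂ] A, ∀ v, levelFun E n (Function.update a z v)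
      = Function.update (levelFun E n a) (target z) (L v) := by
  classical
  have hz := z.2
  by_cases hlt : z.1.length < n
  · refine ⟨LinearMap.id, fun v => funext fun u => ?_⟩
    have hu := u.2
    have htz : z.1.take n = z.1 := List.take_of_length_le hlt.le
    by_cases hut : u = target z
    · subst hut
      have h1 : incl (Nat.le_succ n) (target z) = z := Subtype.ext htz
      have h2 : (target z).1.length < n := by simpa only [target, htz] using hlt
      simp only [levelFun, if_pos h2, h1, Function.update_self, LinearMap.id_apply]
    · rw [Function.update_of_ne hut]
      unfold levelFun
      split_ifs with hul
      · rw [Function.update_of_ne]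
        rintro rfl
        exact hut (Subtype.ext htz.symm)
      · congr 2
        funext y
        unfold starAt
        rw [Function.update_of_ne]
        intro h
        have := congrArg (fun w : Ball k (n + 1) => w.1.length) h
        simp only [List.length_append] at this
        omega
  · have hlen : (z.1.take n).length = n := by rw [List.length_take]; omega
    have hd : (z.1.drop n).length ≤ 1 := by rw [List.length_drop]; omega
    refine ⟨E ∘ₗ (tprod ℂ : MultilinearMap ℂ (fun _ : Ball k 1 => A) _).toLinearMap
      (starAt (target z) a) ⟨z.1.drop n, hd⟩, fun v => funext fun u => ?_⟩
    have hu := u.2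
    by_cases hut : u = target z
    · subst hut
      have hnl : ¬ (target z).1.length < n := by simp only [target, hlen]; omega
      simp only [levelFun, if_neg hnl, Function.update_self, LinearMap.comp_apply,
        MultilinearMap.toLinearMap_apply]
      congr 2
      funext y
      by_cases hy : y = ⟨z.1.drop n, hd⟩
      · subst hy
        simp [starAt, target]
      · rw [Function.update_of_ne hy]
        unfold starAt
        rw [Function.update_of_ne]
        intro h
        apply hy
        have := congrArg (fun w : Ball k (n + 1) => w.1.drop n) h
        simp only [target] at this
        rw [List.drop_append_of_le_length hlen.ge, List.drop_of_length_le hlen.le] at this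
        exact Subtype.ext (by simpa using this)
    · rw [Function.update_of_ne hut]
      unfold levelFun
      split_ifs with hul
      · rw [Function.update_of_ne]
        rintro rfl
        exact hlt hul
      · congr 2
        funext y
        unfold starAt
        rw [Function.update_of_ne]
        intro h
        apply hut
        have := congrArg (fun w : Ball k (n + 1) => w.1.take n) h
        simp only at this
        have hun : u.1.length = n := by omega
        rw [List.take_append_of_le_length hun.ge, List.take_of_length_le hun.le] at this
        exact Subtype.ext this

/-- The quasi-conditional expectation `E_{Λ_n} = id ⊗ ⨂_{u ∈ W_n} 𝓔_u` from the algebra of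
`Λ_{n+1}` to the algebra of `Λ_n`. -/
def levelExp {k : ℕ} (E : BallAlg k A 1 →ₗ[ℂ] A) (n : ℕ) :
    BallAlg k A (n + 1) →ₗ[ℂ] BallAlg k A n :=
  PiTensorProduct.lift
    { toFun := fun a => tprod ℂ (levelFun E n a)
      map_update_add' := by
        classical
        intro _ a z v w
        obtain ⟨L, hL⟩ := levelFun_update E n a z
        simp only [hL, map_add, MultilinearMap.map_update_add]
      map_update_smul' := by
        classical
        intro _ a z c v
        obtain ⟨L, hL⟩ := levelFun_update E n a z
        simp only [hL, map_smul, MultilinearMap.map_update_smul] }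

@[simp] theorem levelExp_tprod {k : ℕ} (E : BallAlg k A 1 →ₗ[ℂ] A) (n : ℕ)
    (a : Ball k (n + 1) → A) : levelExp E n (tprod ℂ a) = tprod ℂ (levelFun E n a) := by
  simp [levelExp]

instance (k : ℕ) : Unique (Ball k 0) where
  default := rootOf k 0
  uniq x := Subtype.ext (List.length_eq_zero_iff.mp (Nat.le_zero.mp x.2))

/-- The identification of the algebra of `Λ_0 = {o}` with `A`. -/
def rootAlg (k : ℕ) : BallAlg k A 0 →ₗ[ℂ] A :=
  (PiTensorProduct.subsingletonEquiv (R := ℂ) (s := fun _ : Ball k 0 => A) (rootOf k 0)).toLinearMap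

/-- The composition `E_{Λ_0} ∘ E_{Λ_1} ∘ ⋯ ∘ E_{Λ_{n-1}}` from the algebra of `Λ_n` to `A`. -/
def iterExp {k : ℕ} (E : BallAlg k A 1 →ₗ[ℂ] A) : (n : ℕ) → BallAlg k A n →ₗ[ℂ] A
  | 0 => rootAlg k
  | n + 1 => iterExp E n ∘ₗ levelExp E n

/-- `E_{o]}` on the algebra of `Λ_n`:
`a ↦ E_{Λ_0} ∘ E_{Λ_1} ∘ ⋯ ∘ E_{Λ_n} (a ⊗ 1_{W_{n+1}})`. -/
def condExpBall {k : ℕ} (E : BallAlg k A 1 →ₗ[ℂ] A) (n : ℕ) : BallAlg k A n →ₗ[ℂ] A :=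
  iterExp E (n + 1) ∘ₗ embed n (n + 1) (Nat.le_succ n)

theorem levelExp_embed {k : ℕ} (E : BallAlg k A 1 →ₗ[ℂ] A) (hE : E 1 = 1) (n : ℕ)
    (a : BallAlg k A n) :
    levelExp E (n + 1) (embed n (n + 2) (by omega) a) = embed n (n + 1) (by omega) a := by
  have : levelExp E (n + 1) ∘ₗ embed n (n + 2) (by omega)
      = (embed n (n + 1) (by omega) : BallAlg k A n →ₗ[ℂ] _) := by
    apply PiTensorProduct.ext
    ext b
    simp only [LinearMap.compMultilinearMap_apply, LinearMap.comp_apply, embed, push_tprod,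
      levelExp_tprod]
    congr 1
    funext u
    have hu := u.2
    unfold levelFun
    split_ifs with hul
    · have h1 : incl (Nat.le_succ (n + 1)) u = incl (by omega) (⟨u.1, by omega⟩ : Ball k n) := rfl
      have h2 : u = incl (by omega) (⟨u.1, by omega⟩ : Ball k n) := rfl
      rw [h1, (incl_injective _).extend_apply]
      conv_rhs => rw [h2]
      rw [(incl_injective _).extend_apply]
    · rw [Function.extend_apply']
      · have h3 : starAt u (Function.extend (incl (by omega)) b 1 : Ball k (n + 2) → A) = 1 := by
          funext y
          unfold starAt
          rw [Function.extend_apply']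
          · rfl
          · rintro ⟨x, hx⟩
            have := congrArg (fun w : Ball k (n + 2) => w.1.length) hx
            have hx2 := x.2
            simp only [incl, List.length_append] at this
            omega
        rw [h3]
        exact hE
      · rintro ⟨x, hx⟩
        have := congrArg (fun w : Ball k (n + 1) => w.1.length) hx
        have hx2 := x.2
        simp only [incl] at this
        omega
  exact LinearMap.congr_fun this a

theorem condExpBall_embed {k : ℕ} (E : BallAlg k A 1 →ₗ[ℂ] A) (hE : E 1 = 1) (m n : ℕ)
    (h : m ≤ n) (a : BallAlg k A m) : condExpBall E n (embed m n h a) = condExpBall E m a := by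
  induction n, h using Nat.le_induction with
  | base => exact congrArg _ (push_id _ _ (fun _ => rfl) a)
  | succ n h ih =>
    rw [← ih]
    have h1 : embed (k := k) n (n + 1) (Nat.le_succ n) (embed m n h a)
        = embed m (n + 1) (h.trans (Nat.le_succ n)) a := push_push _ _ _ _ _ _ (fun _ => rfl) a
    have h2 : embed (k := k) (n + 1) (n + 2) (Nat.le_succ _)
        (embed n (n + 1) (Nat.le_succ n) (embed m n h a))
        = embed n (n + 2) (by omega) (embed m n h a) := push_push _ _ _ _ _ _ (fun _ => rfl) _
    change iterExp E (n + 1) (levelExp E (n + 1) (embed (n + 1) (n + 2) _ _)) = _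
    rw [← h1, h2, levelExp_embed E hE]
    rfl

/-- The conditional expectation `E_{o]}` from the local algebra to `A`, generated by a unital
map `𝓔`. -/
def condExp {k : ℕ} (E : BallAlg k A 1 →ₗ[ℂ] A) (hE : E 1 = 1) : LocalAlg k A →ₗ[ℂ] A :=
  Module.DirectLimit.lift ℂ ℕ (fun n : ℕ => BallAlg k A n) (fun m n h => embed m n h)
    (condExpBall E) (fun m n h a => condExpBall_embed E hE m n h a)

/-! ### Stopping times -/

/-- The element `e^⊥ ⊗ ⋯ ⊗ e^⊥ ⊗ e ⊗ 1` with `e^⊥ = 1 - e` at `x_0, …, x_{n-1}` and `e` at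
`x_n`, the stopping time `τ_{e;x_n}` along the ray `r = (x_n)`. -/
def stopTime {k : ℕ} (e : A) (r : Ray k) (n : ℕ) : BallAlg k A n :=
  open Classical in
  tprod ℂ fun y : Ball k n =>
    if y.1 = r.vert n then e else if ∃ m < n, y.1 = r.vert m then 1 - e else 1

/-- The element `e ⊗ τ_{e;x_n} = α_o(e) · α_{x_1}(τ_{e;x_n})` of the local algebra. -/
def returnTime {k : ℕ} (e : A) (r : Ray k) (n : ℕ) : LocalAlg k A :=
  toLocal k (n + 1) (atRoot k (n + 1) e * shiftBall r.first n (stopTime e r n))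

end Algebra

/-! ### Operator algebras, states and the trace -/

section Operators

variable {H : Type*} [NormedAddCommGroup H] [InnerProductSpace ℂ H] [CompleteSpace H]

/-- Complete positivity of a map `A_o ⊗ A_(1) ⊗ ⋯ ⊗ A_(k) → A`:
`∑ᵢⱼ bᵢ* 𝓔(cᵢ* cⱼ) bⱼ ≥ 0` for all finite families.  By bilinearity it is enough to let the `cᵢ`
be elementary tensors, `cᵢ = ⨂_x a i x`. -/
def IsCompletelyPositive {k : ℕ} {𝔄 : StarSubalgebra ℂ (H →L[ℂ] H)}
    (E : BallAlg k 𝔄 1 →ₗ[ℂ] 𝔄) : Prop :=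
  ∀ (m : ℕ) (a : Fin m → Ball k 1 → 𝔄) (b : Fin m → 𝔄),
    ((∑ i, ∑ j, star (b i) * E (tprod ℂ fun x => star (a i x) * a j x) * b j : 𝔄) :
      H →L[ℂ] H).IsPositive

/-- A Markov transition expectation from `A_o ⊗ A_(1) ⊗ ⋯ ⊗ A_(k)` into `A_o`: a completely
positive identity preserving linear map. -/
structure TransitionExpectation (k : ℕ) (𝔄 : StarSubalgebra ℂ (H →L[ℂ] H)) where
  toMap : BallAlg k 𝔄 1 →ₗ[ℂ] 𝔄
  map_one : toMap 1 = 1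
  completelyPositive : IsCompletelyPositive toMap

/-- A state on the operator algebra `𝔄`. -/
structure State (𝔄 : StarSubalgebra ℂ (H →L[ℂ] H)) where
  toMap : 𝔄 →ₗ[ℂ] ℂ
  map_one : toMap 1 = 1
  nonneg : ∀ a : 𝔄, (a : H →L[ℂ] H).IsPositive →
    0 ≤ (toMap a).re ∧ (toMap a).im = 0

/-- A state is faithful if it vanishes on no nonzero positive element. -/
def State.IsFaithful {𝔄 : StarSubalgebra ℂ (H →L[ℂ] H)} (φ : State 𝔄) : Prop :=
  ∀ a : 𝔄, (a : H →L[ℂ] H).IsPositive → φ.toMap a = 0 → a = 0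

/-- A tree-homogeneous quantum Markov chain `φ ≡ (φ_o, 𝓔)` with trivial boundary condition: an
initial state and a transition expectation such that `φ = φ_o ∘ E_{o]}` is invariant under the
shifts `α_j`. -/
structure HomogeneousQMC (k : ℕ) (𝔄 : StarSubalgebra ℂ (H →L[ℂ] H)) where
  init : State 𝔄
  trans : TransitionExpectation k 𝔄
  shift_invariant : ∀ j : Fin k,
    (init.toMap ∘ₗ condExp trans.toMap trans.map_one) ∘ₗ shift j
      = init.toMap ∘ₗ condExp trans.toMap trans.map_one

variable {k : ℕ} {𝔄 : StarSubalgebra ℂ (H →L[ℂ] H)}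

/-- The conditional expectation `E_{o]}` of the chain. -/
def HomogeneousQMC.cond (φ : HomogeneousQMC k 𝔄) : LocalAlg k 𝔄 →ₗ[ℂ] 𝔄 :=
  condExp φ.trans.toMap φ.trans.map_one

/-- The functional `φ = φ_o ∘ E_{o]}` on the local algebra. -/
def HomogeneousQMC.functional (φ : HomogeneousQMC k 𝔄) : LocalAlg k 𝔄 →ₗ[ℂ] ℂ :=
  φ.init.toMap ∘ₗ φ.cond

/-- The value `φ(α_o(e))`. -/
def HomogeneousQMC.atRootValue (φ : HomogeneousQMC k 𝔄) (e : 𝔄) : ℂ :=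
  φ.functional (toLocal k 0 (atRoot k 0 e))

variable (H) in
/-- An orthonormal (Hilbert) basis of `H`. -/
def stdBasis : HilbertBasis (exists_hilbertBasis ℂ H).choose ℂ H :=
  (exists_hilbertBasis ℂ H).choose_spec.choose

/-- The trace, with values in `[0, ∞]`, of a positive operator. -/
def opTrace (T : H →L[ℂ] H) : ℝ≥0∞ :=
  ∑' i, ENNReal.ofReal (inner ℂ (stdBasis H i) (T (stdBasis H i))).re

theorem ofReal_inner_eq_tsum {T : H →L[ℂ] H} (S : H →L[ℂ] H)
    (hS : T = ContinuousLinearMap.adjoint S ∘L S) {ι : Type*} (c : HilbertBasis ι ℂ H) (v : H) :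
    ENNReal.ofReal (inner ℂ v (T v)).re = ∑' j, ENNReal.ofReal (‖inner ℂ (c j) (S v)‖ ^ 2) := by
  have h1 : (inner ℂ v (T v)).re = ‖S v‖ ^ 2 := by
    rw [hS, ContinuousLinearMap.comp_apply, ContinuousLinearMap.adjoint_inner_right]
    exact inner_self_eq_norm_sq (𝕜 := ℂ) (S v)
  have h2 := c.hasSum_inner_mul_inner (S v) (S v)
  have h3 : HasSum (fun j => ‖inner ℂ (c j) (S v)‖ ^ 2) (‖S v‖ ^ 2) := by
    have h4 := (Complex.hasSum_re h2)
    have h5 : (inner ℂ (S v) (S v)).re = ‖S v‖ ^ 2 := inner_self_eq_norm_sq (𝕜 := ℂ) (S v)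
    rw [h5] at h4
    refine h4.congr_fun ?_
    intro j
    rw [← inner_conj_symm (S v) (c j), ← Complex.normSq_eq_conj_mul_self, Complex.ofReal_re,
      Complex.normSq_eq_norm_sq]
  rw [h1, ← h3.tsum_eq, ENNReal.ofReal_tsum_of_nonneg (fun _ => sq_nonneg _) h3.summable]

/-- The trace of a positive operator does not depend on the orthonormal basis. -/
theorem opTrace_eq_tsum {T : H →L[ℂ] H} (hT : T.IsPositive) {ι : Type*}
    (c : HilbertBasis ι ℂ H) :
    opTrace T = ∑' i, ENNReal.ofReal (inner ℂ (c i) (T (c i))).re := by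
  have h0 : 0 ≤ T := (ContinuousLinearMap.nonneg_iff_isPositive T).mpr hT
  have hsa : IsSelfAdjoint (CFC.sqrt T) := IsSelfAdjoint.of_nonneg (CFC.sqrt_nonneg T)
  have hadj : ContinuousLinearMap.adjoint (CFC.sqrt T) = CFC.sqrt T := hsa.star_eq
  have hS : T = ContinuousLinearMap.adjoint (CFC.sqrt T) ∘L CFC.sqrt T := by
    rw [hadj]
    exact (CFC.sqrt_mul_sqrt_self T h0).symm
  unfold opTrace
  simp only [ofReal_inner_eq_tsum _ hS c (stdBasis H _),
    ofReal_inner_eq_tsum _ hS (stdBasis H) (c _)]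
  rw [ENNReal.tsum_comm]
  refine tsum_congr fun j => tsum_congr fun i => ?_
  rw [← ContinuousLinearMap.adjoint_inner_left, hadj, norm_inner_symm]

/-- `Tr(𝓔(e ⊗ 1))`. -/
def HomogeneousQMC.rootTrace (φ : HomogeneousQMC k 𝔄) (e : 𝔄) : ℝ≥0∞ :=
  opTrace (φ.trans.toMap (atRoot k 1 e) : H →L[ℂ] H)

/-- `e` is `𝓔`-recurrent: `0 < Tr(𝓔(e ⊗ 1)) < ∞`, and
`Tr(E_{o]}(∑ₙ e ⊗ τ_{e;x_n})) / Tr(𝓔(e ⊗ 1)) = 1` for every ray `(x_n)`. -/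
def HomogeneousQMC.IsERecurrent (φ : HomogeneousQMC k 𝔄) (e : 𝔄) : Prop :=
  0 < φ.rootTrace e ∧ φ.rootTrace e < ∞ ∧
    ∀ r : Ray k,
      (∑' n : ℕ, opTrace (φ.cond (returnTime e r n) : H →L[ℂ] H)) / φ.rootTrace e = 1

/-- `e` is `φ`-recurrent: `φ(α_o(e)) ≠ 0`, and
`φ(∑ₙ e ⊗ τ_{e;x_n}) / φ(α_o(e)) = 1` for every ray `(x_n)`. -/
def HomogeneousQMC.IsStateRecurrent (φ : HomogeneousQMC k 𝔄) (e : 𝔄) : Prop :=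
  φ.atRootValue e ≠ 0 ∧
    ∀ r : Ray k, ∃ s : ℂ, HasSum (fun n : ℕ => φ.functional (returnTime e r n)) s ∧
      s / φ.atRootValue e = 1

end Operators

end TreeQMC

end

noncomputable section

namespace TreeQMC

/-! ### Elementary tensors along a ray: first returns and no returns -/

section Patterns

variable {A : Type*} [Ring A]

/-! Both notions of recurrence reduce to the decay of one decreasing sequence. Let `aₙ =
E_{o]}(noReturn n)`, where `noReturn n` carries `e` at the root and `1 - e` at the first `n`
vertices of the shifted ray. Writing `1 = e + (1 - e)` at the next vertex gives `returnTime n +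
noReturn (n + 1) = noReturn n`, and `a₀ = 𝓔(e ⊗ 1)`. Complete positivity makes all images of these
tensors positive, so `aₙ` decreases. The partial sums telescope: under the trace, if `Tr a₀` is
finite and nonzero, 𝓔-recurrence means `Tr aₙ → 0` along every ray; under the state, if `φ_o(a₀) ≠
0`, φ-recurrence means `φ_o(aₙ) → 0` along every ray (`isERecurrent_iff`, `isStateRecurrent_iff`).

On positive elements `φ_o(a) ≤ ‖a‖ ≤ Tr a`, so decay of the traces forces decay of the state values.
Conversely, if `Tr a₀ < ∞`, then `‖aₘ - aₙ‖ ≤ Tr aₘ - Tr aₙ` for `m ≤ n`, so `aₙ` converges in norm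
to some `b ≥ 0` in the closed algebra. Since `b ≤ aₙ`, decay of `φ_o(aₙ)` gives `φ_o(b) = 0`, and
faithfulness gives `b = 0`. Dominated convergence over the diagonal entries, with bound `a₀`, then
yields `Tr aₙ → 0` (`State.IsFaithful.tendsto_opTrace`). Faithfulness also matches the two
nonvanishing conditions on `𝓔(e ⊗ 1)`. -/

theorem Ray.vert_length {k : ℕ} (r : Ray k) (n : ℕ) : (r.vert n).length = n := by
  induction n with
  | zero => simp [r.vert_zero]
  | succ n ih =>
    obtain ⟨j, hj⟩ := r.vert_succ n
    simp [hj, ih]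

theorem Ray.vert_injective {k : ℕ} (r : Ray k) : Function.Injective r.vert := fun m n h => by
  rw [← r.vert_length m, h, r.vert_length]

open Classical in
/-- The pattern with `e` at the root, `1 - e` at the first `n` vertices of the shifted ray, `b` at
its next vertex and `1` elsewhere. -/
def pattern {k : ℕ} (e : A) (r : Ray k) (n : ℕ) (b : A) (v : Vertex k) : A :=
  if v = [] then e
  else if v = r.first :: r.vert n then b
  else if ∃ m < n, v = r.first :: r.vert m then 1 - e else 1

theorem pattern_of_length_lt {k : ℕ} (e : A) (r : Ray k) (n : ℕ) (b : A) (v : Vertex k)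
    (hv : n + 1 < v.length) : pattern e r n b v = 1 := by
  unfold pattern
  rw [if_neg, if_neg, if_neg]
  · rintro ⟨m, hm, rfl⟩
    simp [r.vert_length] at hv
    omega
  · rintro rfl
    simp [r.vert_length] at hv
  · rintro rfl
    simp at hv

theorem pattern_eq_update {k : ℕ} (e : A) (r : Ray k) (n : ℕ) (b c : A) :
    pattern e r n b = Function.update (pattern e r n c) (r.first :: r.vert n) b := by
  funext v
  by_cases hv : v = r.first :: r.vert n
  · subst hv
    simp [pattern]
  · rw [Function.update_of_ne hv]
    simp only [pattern, if_neg hv]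

/-- Surviving one step longer amounts to filling the free slot with `1 - e`; the new free slot holds
`1` and imposes nothing. -/
theorem pattern_succ {k : ℕ} (e : A) (r : Ray k) (n : ℕ) :
    pattern e r (n + 1) 1 = pattern e r n (1 - e) := by
  funext v
  unfold pattern
  by_cases h0 : v = []
  · simp [h0]
  rw [if_neg h0, if_neg h0]
  by_cases h1 : v = r.first :: r.vert n
  · subst h1
    have h2 : r.vert n ≠ r.vert (n + 1) := fun h => by simpa using r.vert_injective h
    rw [if_neg (by simpa using h2), if_pos ⟨n, by omega, rfl⟩, if_pos rfl]
  rw [if_neg h1]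
  by_cases h2 : v = r.first :: r.vert (n + 1)
  · subst h2
    rw [if_pos rfl, if_neg]
    rintro ⟨m, hm, h⟩
    have := r.vert_injective (List.cons_injective h)
    omega
  rw [if_neg h2]
  refine if_congr ⟨?_, ?_⟩ rfl rfl
  · rintro ⟨m, hm, h⟩
    refine ⟨m, lt_of_le_of_ne (Nat.lt_succ_iff.mp hm) ?_, h⟩
    rintro rfl
    exact h1 h
  · rintro ⟨m, hm, h⟩
    exact ⟨m, by omega, h⟩

variable [Algebra ℂ A]

/-- The elementary tensor of the algebra of `Λ_n` whose factor at `x` is `f x`. -/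
def patternTensor {k : ℕ} (n : ℕ) (f : Vertex k → A) : BallAlg k A n :=
  tprod ℂ fun y : Ball k n => f y.1

theorem embed_patternTensor {k m n : ℕ} (h : m ≤ n) (f : Vertex k → A)
    (hf : ∀ x, m < x.length → f x = 1) :
    embed m n h (patternTensor m f) = patternTensor n f := by
  rw [embed, patternTensor, push_tprod]
  congr 1
  funext y
  by_cases hy : y.1.length ≤ m
  · exact (incl_injective h).extend_apply _ _ (⟨y.1, hy⟩ : Ball k m)
  · rw [Function.extend_apply', hf _ (not_le.mp hy), Pi.one_apply]
    rintro ⟨x, rfl⟩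
    exact hy x.2

theorem toLocal_embed {k m n : ℕ} (h : m ≤ n) (a : BallAlg k A m) :
    toLocal k n (embed m n h a) = toLocal k m a :=
  Module.DirectLimit.of_f

/-- Multilinearity in the slot of `b`. It is used with `e` and `1 - e`, which add up to `1`. -/
theorem patternTensor_pattern_add {k : ℕ} (e : A) (r : Ray k) (n : ℕ) (b c : A) :
    patternTensor (n + 1) (pattern e r n b) + patternTensor (n + 1) (pattern e r n c)
      = patternTensor (n + 1) (pattern e r n (b + c)) := by
  classical
  have key : ∀ d : A, (fun y : Ball k (n + 1) => pattern e r n d y.1)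
      = Function.update (fun y : Ball k (n + 1) => pattern e r n 1 y.1)
        ⟨r.first :: r.vert n, by simp [r.vert_length]⟩ d := by
    intro d
    funext y
    rw [pattern_eq_update e r n d 1]
    simp only [Function.update_apply, Subtype.ext_iff]
  unfold patternTensor
  rw [key b, key c, key (b + c), MultilinearMap.map_update_add]

/-- The two tensors being multiplied have disjoint supports, the root and the subtree of `r.first`,
so no factor of the product mixes them. -/
theorem returnTime_eq {k : ℕ} (e : A) (r : Ray k) (n : ℕ) :
    returnTime e r n = toLocal k (n + 1) (patternTensor (n + 1) (pattern e r n e)) := by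
  classical
  rw [returnTime, atRoot, stopTime, shiftBall, push_tprod, tprod_mul_tprod, patternTensor]
  congr 2
  funext y
  obtain ⟨y, hy⟩ := y
  rw [Pi.mul_apply]
  cases y with
  | nil =>
    rw [Function.extend_apply']
    · have : (⟨[], hy⟩ : Ball k (n + 1)) = rootOf k (n + 1) := rfl
      rw [this, Function.update_self]
      simp [pattern, rootOf]
    · rintro ⟨x, hx⟩
      simpa [shiftVertex] using congrArg Subtype.val hx
  | cons i x =>
    rw [Function.update_of_ne, Pi.one_apply, one_mul]
    · by_cases hi : i = r.first
      · subst hi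
        have hx : x.length ≤ n := by simpa using hy
        refine ((shiftVertex_injective r.first n).extend_apply _ _ ⟨x, hx⟩).trans ?_
        simp [pattern]
      · rw [Function.extend_apply']
        · simp [pattern, hi]
        · rintro ⟨z, hz⟩
          have := congrArg Subtype.val hz
          simp only [shiftVertex, List.cons.injEq] at this
          exact hi this.1.symm
    · intro h
      simpa [rootOf] using congrArg Subtype.val h

/-- The element `e ⊗ e^⊥ ⊗ ⋯ ⊗ e^⊥ ⊗ 1`, with `e^⊥` at the first `n` vertices of the shifted ray:
no return before time `n`. -/
def noReturn {k : ℕ} (e : A) (r : Ray k) (n : ℕ) : LocalAlg k A :=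
  toLocal k (n + 1) (patternTensor (n + 1) (pattern e r n 1))

theorem noReturn_zero {k : ℕ} (e : A) (r : Ray k) :
    noReturn e r 0 = toLocal k 0 (atRoot k 0 e) := by
  classical
  have h : atRoot k 0 e = patternTensor 0 (pattern e r 0 1) := by
    unfold atRoot patternTensor
    congr 1
    funext y
    have hy : y = rootOf k 0 := Subsingleton.elim _ _
    subst hy
    simp [pattern, rootOf]
  rw [h, ← toLocal_embed (Nat.zero_le 1), embed_patternTensor, noReturn]
  intro x hx
  have hx0 : x ≠ [] := by rintro rfl; simp at hx
  simp [pattern, hx0]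

/-- The telescoping identity: after no return at the first `n` vertices, the next vertex carries
either `e` or `1 - e`. The two tensors live on different balls and are compared after embedding. -/
theorem returnTime_add_noReturn {k : ℕ} (e : A) (r : Ray k) (n : ℕ) :
    returnTime e r n + noReturn e r (n + 1) = noReturn e r n := by
  rw [returnTime_eq, noReturn, pattern_succ,
    ← embed_patternTensor (Nat.le_succ (n + 1)) _ (fun x hx => pattern_of_length_lt e r n _ x hx),
    toLocal_embed, ← map_add, patternTensor_pattern_add, add_sub_cancel, noReturn]

theorem rootAlg_tprod {k : ℕ} (a : Ball k 0 → A) : rootAlg k (tprod ℂ a) = a (rootOf k 0) :=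
  PiTensorProduct.subsingletonEquiv_apply_tprod _ a

theorem condExp_toLocal {k : ℕ} (E : BallAlg k A 1 →ₗ[ℂ] A) (hE : E 1 = 1) (n : ℕ)
    (a : BallAlg k A n) : condExp E hE (toLocal k n a) = condExpBall E n a :=
  Module.DirectLimit.lift_of ..

/-- Ties `E_{o]}` of the initial term to `𝓔(e ⊗ 1)`, from which both normalizing constants are
computed. -/
theorem condExpBall_zero_atRoot {k : ℕ} (E : BallAlg k A 1 →ₗ[ℂ] A) (e : A) :
    condExpBall E 0 (atRoot k 0 e) = E (atRoot k 1 e) := by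
  classical
  change rootAlg k (levelExp E 0 (push _ (incl_injective (Nat.le_succ 0)) (tprod ℂ _))) = _
  rw [push_tprod, levelExp_tprod, rootAlg_tprod, extend_update _ (incl_injective (Nat.le_succ 0))]
  unfold levelFun
  rw [if_neg (Nat.not_lt_zero _), atRoot]
  congr 2
  funext y
  have h1 : Function.extend (incl (Nat.le_succ 0)) (1 : Ball k 0 → A) 1 = 1 := by
    funext z
    by_cases hz : ∃ x, incl (Nat.le_succ 0) x = z
    · obtain ⟨x, rfl⟩ := hz
      rw [(incl_injective _).extend_apply]; rfl
    · rw [Function.extend_apply' _ _ _ hz]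
  rw [h1]
  rfl

/-- If `P` holds for `1` and `E` sends elementary tensors with factors in `P` into `P`, then so
does `E_{o]}`. -/
theorem condExp_patternTensor_induction {k : ℕ} (E : BallAlg k A 1 →ₗ[ℂ] A) (hE : E 1 = 1)
    (P : A → Prop) (h1 : P 1) (hP : ∀ a : Ball k 1 → A, (∀ y, P (a y)) → P (E (tprod ℂ a)))
    (n : ℕ) (f : Vertex k → A) (hf : ∀ x, P (f x)) :
    P (condExp E hE (toLocal k n (patternTensor n f))) := by
  classical
  -- The family must stay arbitrary: each `levelExp` returns an elementary tensor again, with new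
  -- factors that still satisfy `P`.
  have hiter : ∀ (m : ℕ) (a : Ball k m → A), (∀ y, P (a y)) → P (iterExp E m (tprod ℂ a)) := by
    intro m
    induction m with
    | zero =>
      intro a ha
      change P (rootAlg k _)
      rw [rootAlg_tprod]
      exact ha _
    | succ m ih =>
      intro a ha
      change P (iterExp E m (levelExp E m _))
      rw [levelExp_tprod]
      refine ih _ fun u => ?_
      unfold levelFun
      split_ifs
      · exact ha _
      · exact hP _ fun y => ha _
  rw [condExp_toLocal]
  change P (iterExp E (n + 1) (push _ _ (tprod ℂ _)))
  rw [push_tprod]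
  refine hiter _ _ fun y => ?_
  by_cases hy : ∃ x, incl (Nat.le_succ n) x = y
  · obtain ⟨x, rfl⟩ := hy
    rw [(incl_injective _).extend_apply]
    exact hf _
  · rw [Function.extend_apply' _ _ _ hy]
    exact h1

end Patterns

/-! ### Trace, operator norm and monotone sequences of positive operators -/

section Trace

open Filter Topology

variable {H : Type*} [NormedAddCommGroup H] [InnerProductSpace ℂ H]

theorem re_inner_nonneg {T : H →L[ℂ] H} (hT : T.IsPositive) (v : H) :
    0 ≤ (inner ℂ v (T v)).re :=
  hT.re_inner_nonneg_right v

variable [CompleteSpace H]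

theorem opTrace_add {S T : H →L[ℂ] H} (hS : S.IsPositive) (hT : T.IsPositive) :
    opTrace (S + T) = opTrace S + opTrace T := by
  unfold opTrace
  rw [← ENNReal.tsum_add]
  refine tsum_congr fun i => ?_
  rw [add_apply, inner_add_right, Complex.add_re,
    ENNReal.ofReal_add (re_inner_nonneg hS _) (re_inner_nonneg hT _)]

@[simp] theorem opTrace_zero : opTrace (0 : H →L[ℂ] H) = 0 := by
  simp [opTrace]

/-- The operator norm of a positive operator is at most its trace. -/
theorem ofReal_norm_le_opTrace {T : H →L[ℂ] H} (hT : T.IsPositive) :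
    ENNReal.ofReal ‖T‖ ≤ opTrace T := by
  by_cases htop : opTrace T = ⊤
  · simp [htop]
  have h0 : 0 ≤ T := (ContinuousLinearMap.nonneg_iff_isPositive T).mpr hT
  set S : H →L[ℂ] H := CFC.sqrt T
  have hsa : IsSelfAdjoint S := IsSelfAdjoint.of_nonneg (CFC.sqrt_nonneg T)
  have hadj : ContinuousLinearMap.adjoint S = S := hsa.star_eq
  have hST : T = ContinuousLinearMap.adjoint S ∘L S := by
    rw [hadj]
    exact (CFC.sqrt_mul_sqrt_self T h0).symm
  have hnorm : ‖T‖ = ‖S‖ * ‖S‖ := by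
    rw [hST]
    exact CStarRing.norm_star_mul_self
  have hvec : ∀ v : H, ‖S v‖ ^ 2 ≤ (opTrace T).toReal * ‖v‖ ^ 2 := by
    intro v
    have hv : (inner ℂ v (T v)).re = ‖S v‖ ^ 2 := by
      rw [hST, ContinuousLinearMap.comp_apply, ContinuousLinearMap.adjoint_inner_right]
      exact inner_self_eq_norm_sq (𝕜 := ℂ) (S v)
    -- Parseval, then self-adjointness of `S = √T` and Cauchy–Schwarz: `‖S v‖² = ∑ |⟨bᵢ, S v⟩|² = ∑
    -- |⟨S bᵢ, v⟩|² ≤ (∑ ‖S bᵢ‖²) ‖v‖²`, and the last sum is the trace of `T`.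
    have hle : ENNReal.ofReal (‖S v‖ ^ 2) ≤ opTrace T * ENNReal.ofReal (‖v‖ ^ 2) := by
      rw [← hv, ofReal_inner_eq_tsum S hST (stdBasis H) v, opTrace, ← ENNReal.tsum_mul_right]
      refine ENNReal.tsum_le_tsum fun i => ?_
      have hi : (inner ℂ (stdBasis H i) (T (stdBasis H i))).re = ‖S (stdBasis H i)‖ ^ 2 := by
        rw [hST, ContinuousLinearMap.comp_apply, ContinuousLinearMap.adjoint_inner_right]
        exact inner_self_eq_norm_sq (𝕜 := ℂ) _
      rw [hi, ← ENNReal.ofReal_mul (sq_nonneg _), ← mul_pow]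
      refine ENNReal.ofReal_le_ofReal (pow_le_pow_left₀ (norm_nonneg _) ?_ 2)
      rw [← ContinuousLinearMap.adjoint_inner_left, hadj]
      exact norm_inner_le_norm _ _
    have := ENNReal.toReal_mono (ENNReal.mul_ne_top htop ENNReal.ofReal_ne_top) hle
    rwa [ENNReal.toReal_mul, ENNReal.toReal_ofReal (sq_nonneg _),
      ENNReal.toReal_ofReal (sq_nonneg _)] at this
  have hS : ‖S‖ ≤ √(opTrace T).toReal := by
    refine S.opNorm_le_bound (Real.sqrt_nonneg _) fun v => ?_
    rw [← Real.sqrt_sq (norm_nonneg v), ← Real.sqrt_mul ENNReal.toReal_nonneg]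
    exact Real.le_sqrt_of_sq_le (hvec v)
  rw [hnorm]
  refine ENNReal.ofReal_le_of_le_toReal ?_
  calc ‖S‖ * ‖S‖ ≤ √(opTrace T).toReal * √(opTrace T).toReal :=
        mul_le_mul hS hS (norm_nonneg _) (Real.sqrt_nonneg _)
    _ = _ := Real.mul_self_sqrt ENNReal.toReal_nonneg

theorem tendsto_zero_of_tendsto_opTrace {a : ℕ → H →L[ℂ] H} (ha : ∀ n, (a n).IsPositive)
    (h : Tendsto (fun n => opTrace (a n)) atTop (𝓝 0)) : Tendsto a atTop (𝓝 0) := by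
  rw [tendsto_zero_iff_norm_tendsto_zero]
  have h1 : Tendsto (fun n => ENNReal.ofReal ‖a n‖) atTop (𝓝 0) :=
    tendsto_of_tendsto_of_tendsto_of_le_of_le tendsto_const_nhds h (fun _ => zero_le)
      fun n => ofReal_norm_le_opTrace (ha n)
  have h2 := (ENNReal.tendsto_toReal ENNReal.zero_ne_top).comp h1
  simpa [Function.comp_def] using h2

/-- A decreasing sequence of positive operators of finite trace converges in norm. -/
theorem cauchySeq_of_antitone {a : ℕ → H →L[ℂ] H} (ha : ∀ n, (a n).IsPositive)
    (hanti : Antitone a) (hfin : opTrace (a 0) ≠ ⊤) : CauchySeq a := by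
  have hadd : ∀ {m n}, m ≤ n → opTrace (a m) = opTrace (a n) + opTrace (a m - a n) := by
    intro m n hmn
    rw [← opTrace_add (ha n) (hanti hmn), add_sub_cancel]
  have hfin' : ∀ n, opTrace (a n) ≠ ⊤ := fun n h => hfin (by simp [hadd (Nat.zero_le n), h])
  -- The norm of the positive difference is at most its trace, which by additivity is a difference
  -- of real numbers. Cauchyness then comes from the bounded monotone sequence of traces.
  have hdiff : ∀ {m n}, m ≤ n →
      ‖a m - a n‖ ≤ (opTrace (a m)).toReal - (opTrace (a n)).toReal := by
    intro m n hmn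
    have hne : opTrace (a m - a n) ≠ ⊤ := fun h => hfin' m (by simp [hadd hmn, h])
    have h1 := ENNReal.toReal_mono hne (ofReal_norm_le_opTrace (hanti hmn))
    rw [ENNReal.toReal_ofReal (norm_nonneg _)] at h1
    rw [hadd hmn, ENNReal.toReal_add (hfin' n) hne]
    linarith
  have htr : CauchySeq fun n => (opTrace (a n)).toReal := by
    refine (tendsto_atTop_ciInf ?_ ⟨0, ?_⟩).cauchySeq
    · intro m n hmn
      have := (norm_nonneg _).trans (hdiff hmn)
      simpa using this
    · rintro _ ⟨n, rfl⟩
      exact ENNReal.toReal_nonneg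
  rw [Metric.cauchySeq_iff] at htr ⊢
  intro ε hε
  obtain ⟨N, hN⟩ := htr ε hε
  refine ⟨N, fun m hm n hn => ?_⟩
  refine lt_of_le_of_lt ?_ (hN m hm n hn)
  rw [dist_eq_norm, Real.dist_eq]
  rcases le_total m n with h | h
  · exact (hdiff h).trans (le_abs_self _)
  · rw [norm_sub_rev, abs_sub_comm]
    exact (hdiff h).trans (le_abs_self _)

/-- Dominated convergence for the trace. -/
theorem tendsto_opTrace_zero {a : ℕ → H →L[ℂ] H} {T : H →L[ℂ] H}
    (ha : ∀ n, (a n).IsPositive) (haT : ∀ n, a n ≤ T) (hfin : opTrace T ≠ ⊤)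
    (hlim : Tendsto a atTop (𝓝 0)) : Tendsto (fun n => opTrace (a n)) atTop (𝓝 0) := by
  have hT : ∀ v, 0 ≤ (inner ℂ v (T v)).re := fun v => by
    have := re_inner_nonneg ((ha 0).add (haT 0)) v
    rwa [add_sub_cancel] at this
  have hle : ∀ n v, (inner ℂ v (a n v)).re ≤ (inner ℂ v (T v)).re := fun n v => by
    have := re_inner_nonneg (haT n) v
    rw [sub_apply, inner_sub_right, Complex.sub_re] at this
    exact sub_nonneg.mp this
  -- Finite trace makes the diagonal of `T` a summable majorant for the diagonals of all `a n`.
  have hsum : Summable fun i => (inner ℂ (stdBasis H i) (T (stdBasis H i))).re := by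
    have := ENNReal.summable_toReal hfin
    simpa only [ENNReal.toReal_ofReal (hT _)] using this
  have h1 : Tendsto (fun n => ∑' i, (inner ℂ (stdBasis H i) (a n (stdBasis H i))).re) atTop
      (𝓝 (∑' i, (inner ℂ (stdBasis H i) ((0 : H →L[ℂ] H) (stdBasis H i))).re)) := by
    refine tendsto_tsum_of_dominated_convergence hsum (fun i => ?_) (.of_forall fun n i => ?_)
    · have hc : Continuous fun S : H →L[ℂ] H => (inner ℂ (stdBasis H i) (S (stdBasis H i))).re := by
        fun_prop
      exact (hc.tendsto 0).comp hlim
    · rw [Real.norm_of_nonneg (re_inner_nonneg (ha n) _)]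
      exact hle n _
  have h2 := ENNReal.tendsto_ofReal h1
  simp only [zero_apply, inner_zero_right, Complex.zero_re, tsum_zero,
    ENNReal.ofReal_zero] at h2
  refine h2.congr fun n => ?_
  rw [opTrace, ENNReal.ofReal_tsum_of_nonneg (fun i => re_inner_nonneg (ha n) _)]
  exact Summable.of_nonneg_of_le (fun i => re_inner_nonneg (ha n) _) (fun i => hle n _) hsum

end Trace

/-! ### Positivity, states and the two recurrence criteria -/

section Recurrence

open Filter Topology

variable {H : Type*} [NormedAddCommGroup H] [InnerProductSpace ℂ H] [CompleteSpace H]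
  {𝔄 : StarSubalgebra ℂ (H →L[ℂ] H)}

/-- A positive element of a norm closed algebra is of the form `s* s` with `s` in the algebra. -/
theorem exists_star_mul_self (hclosed : IsClosed (𝔄 : Set (H →L[ℂ] H))) {a : 𝔄}
    (ha : (a : H →L[ℂ] H).IsPositive) : ∃ s : 𝔄, star s * s = a := by
  have : IsClosed (𝔄 : Set (H →L[ℂ] H)) := hclosed
  have h0 : 0 ≤ (a : H →L[ℂ] H) := (ContinuousLinearMap.nonneg_iff_isPositive _).mpr ha
  have hsa : star (CFC.sqrt (a : H →L[ℂ] H)) = CFC.sqrt (a : H →L[ℂ] H) :=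
    (IsSelfAdjoint.of_nonneg (CFC.sqrt_nonneg _)).star_eq
  -- The root is a continuous function of `a`, so it stays in the closed unital star-subalgebra;
  -- hence the passage to the unital calculus.
  have hmem : CFC.sqrt (a : H →L[ℂ] H) ∈ 𝔄 := by
    rw [CFC.sqrt_eq_real_sqrt _ h0, cfcₙ_eq_cfc]
    exact cfc_mem (𝕜' := ℂ) Real.sqrt a.2
  refine ⟨⟨_, hmem⟩, Subtype.ext ?_⟩
  change star (CFC.sqrt (a : H →L[ℂ] H)) * CFC.sqrt (a : H →L[ℂ] H) = a
  rw [hsa]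
  exact CFC.sqrt_mul_sqrt_self _ h0

/-- A transition expectation sends elementary tensors of positive elements to positive elements. -/
theorem TransitionExpectation.isPositive_tprod {k : ℕ} (E : TransitionExpectation k 𝔄)
    (hclosed : IsClosed (𝔄 : Set (H →L[ℂ] H))) (a : Ball k 1 → 𝔄)
    (ha : ∀ y, (a y : H →L[ℂ] H).IsPositive) : (E.toMap (tprod ℂ a) : H →L[ℂ] H).IsPositive := by
  choose s hs using fun y => exists_star_mul_self hclosed (ha y)
  -- One term suffices: with `a y = (s y)* s y` and `b = 1`, the complete positivity sum is `𝓔(⨂ a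
  -- y)` itself.
  have := E.completelyPositive 1 (fun _ => s) fun _ => 1
  simpa [hs] using this

/-- A state is bounded by the norm on positive elements. -/
theorem State.re_le_norm (φ : State 𝔄) {a : 𝔄} (ha : (a : H →L[ℂ] H).IsPositive) :
    (φ.toMap a).re ≤ ‖(a : H →L[ℂ] H)‖ := by
  have h1 : (((‖(a : H →L[ℂ] H)‖ : ℂ) • (1 : 𝔄) - a : 𝔄) : H →L[ℂ] H).IsPositive := by
    have := IsSelfAdjoint.le_algebraMap_norm_self (a := (a : H →L[ℂ] H)) ha.isSelfAdjoint
    rw [ContinuousLinearMap.le_def] at this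
    convert this using 1
    ext v
    simp [Algebra.algebraMap_eq_smul_one]
  have h2 := (φ.nonneg _ h1).1
  rw [map_sub, map_smul, φ.map_one] at h2
  simpa using h2

theorem State.map_eq_ofReal (φ : State 𝔄) {a : 𝔄} (ha : (a : H →L[ℂ] H).IsPositive) :
    φ.toMap a = ((φ.toMap a).re : ℂ) :=
  Complex.ext rfl (by simpa using (φ.nonneg a ha).2)

theorem State.norm_le (φ : State 𝔄) {a : 𝔄} (ha : (a : H →L[ℂ] H).IsPositive) :
    ‖φ.toMap a‖ ≤ ‖(a : H →L[ℂ] H)‖ := by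
  rw [φ.map_eq_ofReal ha, Complex.norm_real, Real.norm_of_nonneg (φ.nonneg a ha).1]
  exact φ.re_le_norm ha

theorem State.tendsto_of_tendsto_opTrace (φ : State 𝔄) {a : ℕ → 𝔄}
    (ha : ∀ n, (a n : H →L[ℂ] H).IsPositive)
    (h : Tendsto (fun n => opTrace (a n : H →L[ℂ] H)) atTop (𝓝 0)) :
    Tendsto (fun n => φ.toMap (a n)) atTop (𝓝 0) :=
  squeeze_zero_norm (fun n => φ.norm_le (ha n))
    (tendsto_zero_iff_norm_tendsto_zero.mp (tendsto_zero_of_tendsto_opTrace ha h))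

theorem State.IsFaithful.tendsto_opTrace {φ : State 𝔄} (hφ : φ.IsFaithful)
    (hclosed : IsClosed (𝔄 : Set (H →L[ℂ] H))) {a : ℕ → 𝔄}
    (ha : ∀ n, (a n : H →L[ℂ] H).IsPositive)
    (hanti : Antitone fun n => (a n : H →L[ℂ] H))
    (hfin : opTrace (a 0 : H →L[ℂ] H) ≠ ⊤) (h : Tendsto (fun n => φ.toMap (a n)) atTop (𝓝 0)) :
    Tendsto (fun n => opTrace (a n : H →L[ℂ] H)) atTop (𝓝 0) := by
  obtain ⟨b, hb⟩ := cauchySeq_tendsto_of_complete (cauchySeq_of_antitone ha hanti hfin)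
  have hmem : b ∈ 𝔄 := hclosed.mem_of_tendsto hb (.of_forall fun n => (a n).2)
  have hble : ∀ n, b ≤ a n := fun n => hanti.le_of_tendsto hb n
  have hbpos : b.IsPositive := by
    rw [← ContinuousLinearMap.nonneg_iff_isPositive]
    exact ge_of_tendsto' hb fun n => (ContinuousLinearMap.nonneg_iff_isPositive _).mpr (ha n)
  have hval : φ.toMap ⟨b, hmem⟩ = 0 := by
    -- Only the order is used: `b ≤ a n` gives `φ b ≤ φ (a n)`, and the right side tends to zero.
    have h0 : (φ.toMap ⟨b, hmem⟩).re ≤ 0 := by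
      refine ge_of_tendsto' ((Complex.continuous_re.tendsto 0).comp h) fun n => ?_
      have := (φ.nonneg (a n - ⟨b, hmem⟩) (hble n)).1
      rw [map_sub, Complex.sub_re] at this
      exact sub_nonneg.mp this
    rw [φ.map_eq_ofReal hbpos, le_antisymm h0 (φ.nonneg _ hbpos).1, Complex.ofReal_zero]
  obtain rfl : b = 0 := congrArg Subtype.val (hφ _ hbpos hval)
  exact tendsto_opTrace_zero ha (fun n => hanti (Nat.zero_le n)) hfin hb

variable {k : ℕ} (φ : HomogeneousQMC k 𝔄)

/-- All factors are positive, and this survives each level of `E_{o]}`. The slot `b` is general in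
order to cover both `e` (return) and `1` (no return). -/
theorem HomogeneousQMC.isPositive_cond_pattern (hclosed : IsClosed (𝔄 : Set (H →L[ℂ] H)))
    {e : 𝔄} (he : IsStarProjection e) (r : Ray k) (n : ℕ) {b : 𝔄}
    (hb : (b : H →L[ℂ] H).IsPositive) (m : ℕ) :
    (φ.cond (toLocal k m (patternTensor m (pattern e r n b))) : H →L[ℂ] H).IsPositive := by
  have hproj : ∀ {p : 𝔄}, IsStarProjection p → (p : H →L[ℂ] H).IsPositive := fun hp =>
    .of_isStarProjection (hp.map 𝔄.subtype)
  refine condExp_patternTensor_induction φ.trans.toMap φ.trans.map_one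
    (fun a : 𝔄 => (a : H →L[ℂ] H).IsPositive) (hproj (.one 𝔄))
    (φ.trans.isPositive_tprod hclosed) m _ fun x => ?_
  simp only [pattern]
  split_ifs
  exacts [hproj he, hb, hproj he.one_sub, hproj (.one 𝔄)]

theorem HomogeneousQMC.isPositive_cond_returnTime (hclosed : IsClosed (𝔄 : Set (H →L[ℂ] H)))
    {e : 𝔄} (he : IsStarProjection e) (r : Ray k) (n : ℕ) :
    (φ.cond (returnTime e r n) : H →L[ℂ] H).IsPositive := by
  rw [returnTime_eq]
  exact φ.isPositive_cond_pattern hclosed he r n (.of_isStarProjection (he.map 𝔄.subtype)) _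

theorem HomogeneousQMC.isPositive_cond_noReturn (hclosed : IsClosed (𝔄 : Set (H →L[ℂ] H)))
    {e : 𝔄} (he : IsStarProjection e) (r : Ray k) (n : ℕ) :
    (φ.cond (noReturn e r n) : H →L[ℂ] H).IsPositive :=
  φ.isPositive_cond_pattern hclosed he r n ContinuousLinearMap.isPositive_one _

theorem HomogeneousQMC.cond_returnTime_add (e : 𝔄) (r : Ray k) (n : ℕ) :
    φ.cond (returnTime e r n) + φ.cond (noReturn e r (n + 1)) = φ.cond (noReturn e r n) := by
  rw [← map_add, returnTime_add_noReturn]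

theorem HomogeneousQMC.cond_noReturn_zero (e : 𝔄) (r : Ray k) :
    φ.cond (noReturn e r 0) = φ.trans.toMap (atRoot k 1 e) := by
  rw [noReturn_zero, ← condExpBall_zero_atRoot]
  exact condExp_toLocal ..

theorem HomogeneousQMC.atRootValue_eq (e : 𝔄) :
    φ.atRootValue e = φ.init.toMap (φ.trans.toMap (atRoot k 1 e)) := by
  rw [← condExpBall_zero_atRoot]
  exact congrArg φ.init.toMap (condExp_toLocal ..)

theorem HomogeneousQMC.antitone_cond_noReturn (hclosed : IsClosed (𝔄 : Set (H →L[ℂ] H)))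
    {e : 𝔄} (he : IsStarProjection e) (r : Ray k) :
    Antitone fun n => (φ.cond (noReturn e r n) : H →L[ℂ] H) := by
  refine antitone_nat_of_succ_le fun n => ?_
  have := φ.isPositive_cond_returnTime hclosed he r n
  rw [ContinuousLinearMap.le_def, ← φ.cond_returnTime_add e r n]
  simpa using this

/-- The trace condition for recurrence along a ray says that the traces of the events of no return
tend to zero. -/
theorem HomogeneousQMC.tsum_opTrace_eq_iff (hclosed : IsClosed (𝔄 : Set (H →L[ℂ] H)))
    {e : 𝔄} (he : IsStarProjection e) (hfin : φ.rootTrace e ≠ ⊤) (r : Ray k) :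
    ∑' n, opTrace (φ.cond (returnTime e r n) : H →L[ℂ] H) = φ.rootTrace e ↔
      Tendsto (fun n => opTrace (φ.cond (noReturn e r n) : H →L[ℂ] H)) atTop (𝓝 0) := by
  have hsum : ∀ N, ∑ n ∈ Finset.range N, opTrace (φ.cond (returnTime e r n) : H →L[ℂ] H)
      + opTrace (φ.cond (noReturn e r N) : H →L[ℂ] H) = φ.rootTrace e := by
    intro N
    induction N with
    | zero => simp [φ.cond_noReturn_zero, rootTrace]
    | succ N ih =>
      rw [Finset.sum_range_succ, add_assoc, ← opTrace_add
        (φ.isPositive_cond_returnTime hclosed he r N)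
        (φ.isPositive_cond_noReturn hclosed he r (N + 1)), ← ih, ← φ.cond_returnTime_add e r N]
      rfl
  have hlim := ENNReal.tendsto_nat_tsum
    fun n => opTrace (φ.cond (returnTime e r n) : H →L[ℂ] H)
  constructor
  · intro h
    rw [h] at hlim
    -- Finiteness of the total trace enters here: it makes subtraction in `[0, ∞]` continuous and
    -- recovers the remainder from the partial sums.
    have h1 := ENNReal.Tendsto.sub (tendsto_const_nhds (x := φ.rootTrace e)) hlim (Or.inl hfin)
    rw [tsub_self] at h1
    refine h1.congr fun N => ?_
    refine ENNReal.sub_eq_of_eq_add_rev (fun h => hfin ?_) (hsum N).symm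
    rw [← hsum N, h, top_add]
  · intro h
    have h1 := hlim.add h
    simp only [hsum, add_zero] at h1
    exact tendsto_nhds_unique h1 tendsto_const_nhds

/-- The state condition for recurrence along a ray says that the probabilities of no return tend
to zero. -/
theorem HomogeneousQMC.hasSum_functional_iff (hclosed : IsClosed (𝔄 : Set (H →L[ℂ] H)))
    {e : 𝔄} (he : IsStarProjection e) (r : Ray k) :
    HasSum (fun n => φ.functional (returnTime e r n)) (φ.atRootValue e) ↔
      Tendsto (fun n => φ.init.toMap (φ.cond (noReturn e r n))) atTop (𝓝 0) := by
  have hsum : ∀ N, ∑ n ∈ Finset.range N, φ.functional (returnTime e r n)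
      + φ.init.toMap (φ.cond (noReturn e r N)) = φ.atRootValue e := by
    intro N
    induction N with
    | zero => simp [φ.cond_noReturn_zero, φ.atRootValue_eq]
    | succ N ih =>
      rw [← ih, ← φ.cond_returnTime_add e r N, map_add, Finset.sum_range_succ, add_assoc]
      rfl
  have hpos := fun n => φ.isPositive_cond_returnTime hclosed he r n
  constructor
  · intro h
    have h1 := (tendsto_const_nhds (x := φ.atRootValue e)).sub h.tendsto_sum_nat
    rw [sub_self] at h1
    exact h1.congr fun N => by rw [← hsum N, add_sub_cancel_left]
  · intro h
    have h1 := (tendsto_const_nhds (x := φ.atRootValue e)).sub h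
    rw [sub_zero] at h1
    have h2 : Tendsto (fun N => ∑ n ∈ Finset.range N, φ.functional (returnTime e r n)) atTop
        (𝓝 (φ.atRootValue e)) := h1.congr fun N => by rw [← hsum N, add_sub_cancel_right]
    -- `HasSum` is unconditional, so convergence of partial sums is not enough by itself; it
    -- suffices here because the terms are nonnegative reals.
    have hreal : ∀ n, φ.functional (returnTime e r n)
        = ((φ.functional (returnTime e r n)).re : ℂ) := fun n => φ.init.map_eq_ofReal (hpos n)
    have h3 : HasSum (fun n => (φ.functional (returnTime e r n)).re) (φ.atRootValue e).re := by
      rw [hasSum_iff_tendsto_nat_of_nonneg fun n => show 0 ≤ (φ.functional (returnTime e r n)).re from (φ.init.nonneg _ (hpos n)).1]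
      simpa [Function.comp_def] using (Complex.continuous_re.tendsto _).comp h2
    have h4 := (Complex.hasSum_ofReal).mpr h3
    simp only [← hreal] at h4
    exact (tendsto_nhds_unique h4.tendsto_sum_nat h2) ▸ h4

theorem HomogeneousQMC.isERecurrent_iff (hclosed : IsClosed (𝔄 : Set (H →L[ℂ] H)))
    {e : 𝔄} (he : IsStarProjection e) :
    φ.IsERecurrent e ↔ 0 < φ.rootTrace e ∧ φ.rootTrace e < ⊤ ∧ ∀ r : Ray k,
      Tendsto (fun n => opTrace (φ.cond (noReturn e r n) : H →L[ℂ] H)) atTop (𝓝 0) := by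
  refine and_congr_right fun h0 => and_congr_right fun h1 => forall_congr' fun r => ?_
  rw [ENNReal.div_eq_one_iff h0.ne' h1.ne, φ.tsum_opTrace_eq_iff hclosed he h1.ne]

theorem HomogeneousQMC.isStateRecurrent_iff (hclosed : IsClosed (𝔄 : Set (H →L[ℂ] H)))
    {e : 𝔄} (he : IsStarProjection e) :
    φ.IsStateRecurrent e ↔ φ.atRootValue e ≠ 0 ∧ ∀ r : Ray k,
      Tendsto (fun n => φ.init.toMap (φ.cond (noReturn e r n))) atTop (𝓝 0) := by
  refine and_congr_right fun h0 => forall_congr' fun r => ?_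
  rw [← φ.hasSum_functional_iff hclosed he]
  constructor
  · rintro ⟨s, hs, h1⟩
    rwa [(div_eq_one_iff_eq h0).mp h1] at hs
  · exact fun h => ⟨_, h, div_self h0⟩

theorem HomogeneousQMC.IsERecurrent.isStateRecurrent {φ : HomogeneousQMC k 𝔄}
    (hclosed : IsClosed (𝔄 : Set (H →L[ℂ] H))) {e : 𝔄} (he : IsStarProjection e)
    (h : φ.IsERecurrent e) (h0 : φ.atRootValue e ≠ 0) : φ.IsStateRecurrent e :=
  (φ.isStateRecurrent_iff hclosed he).mpr ⟨h0, fun r =>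
    φ.init.tendsto_of_tendsto_opTrace (φ.isPositive_cond_noReturn hclosed he r)
      (((φ.isERecurrent_iff hclosed he).mp h).2.2 r)⟩

theorem HomogeneousQMC.isPositive_root (hclosed : IsClosed (𝔄 : Set (H →L[ℂ] H)))
    {e : 𝔄} (he : IsStarProjection e) :
    (φ.trans.toMap (atRoot k 1 e) : H →L[ℂ] H).IsPositive := by
  refine φ.trans.isPositive_tprod hclosed _ fun y => ?_
  rw [Function.update_apply]
  split_ifs
  · exact .of_isStarProjection (he.map 𝔄.subtype)
  · exact ContinuousLinearMap.isPositive_one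

end Recurrence

end TreeQMC

end

theorem mainTheorem2 {H : Type*} [NormedAddCommGroup H] [InnerProductSpace ℂ H] [CompleteSpace H]
    (𝔄 : StarSubalgebra ℂ (H →L[ℂ] H)) (hclosed : IsClosed (𝔄 : Set (H →L[ℂ] H)))
    (k : ℕ) (hk : 1 ≤ k) (φ : TreeQMC.HomogeneousQMC k 𝔄) :
    (∀ e : 𝔄, IsStarProjection e → φ.IsERecurrent e → φ.atRootValue e ≠ 0 →
      φ.IsStateRecurrent e) ∧
    (φ.init.IsFaithful → ∀ e : 𝔄, IsStarProjection e →
      (φ.IsERecurrent e → φ.IsStateRecurrent e) ∧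
      (φ.rootTrace e < ⊤ → φ.IsStateRecurrent e → φ.IsERecurrent e)) := by
  refine ⟨fun e he h h0 => h.isStateRecurrent hclosed he h0, fun hf e he => ⟨fun h => ?_, ?_⟩⟩
  -- If `φ_o` vanished on the positive element `𝓔(e ⊗ 1)`, faithfulness would make that element
  -- zero, against its positive trace.
  · refine h.isStateRecurrent hclosed he fun h0 => h.1.ne' ?_
    rw [φ.atRootValue_eq] at h0
    have hzero := hf _ (φ.isPositive_root hclosed he) h0
    rw [TreeQMC.HomogeneousQMC.rootTrace, hzero]
    exact TreeQMC.opTrace_zero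
  · intro hfin h
    obtain ⟨h0, hlim⟩ := (φ.isStateRecurrent_iff hclosed he).mp h
    refine (φ.isERecurrent_iff hclosed he).mpr ⟨?_, hfin, fun r => ?_⟩
    -- Zero trace forces zero norm, hence `𝓔(e ⊗ 1) = 0` and `φ(α_o(e)) = 0`.
    · refine pos_iff_ne_zero.mpr fun htr => h0 ?_
      have hle := TreeQMC.ofReal_norm_le_opTrace (φ.isPositive_root hclosed he)
      have hroot : φ.trans.toMap (TreeQMC.atRoot k 1 e) = 0 := by
        refine Subtype.ext (norm_le_zero_iff.mp (ENNReal.ofReal_eq_zero.mp ?_))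
        exact le_antisymm (hle.trans htr.le) zero_le
      rw [φ.atRootValue_eq, hroot, map_zero]
    · refine hf.tendsto_opTrace hclosed (φ.isPositive_cond_noReturn hclosed he r)
        (φ.antitone_cond_noReturn hclosed he r) ?_ (hlim r)
      rw [φ.cond_noReturn_zero]
      exact hfin.ne
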